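/- Let $G=(V,E)$ be a finite or locally finite graph with symmetric positive edge weights $w_{xy}=w_{yx}>0$ ($xy\in E$) and a positive vertex measure $\mu:V\to(0,\infty)$. Write $y\sim x$ for $xy\in E$, $\deg(x)=\sum_{y\sim x}w_{xy}$ and $\Delta f(x)=\frac1{\mu(x)}\sum_{y\sim x}w_{xy}(f(y)-f(x))$. Assume $$D_\mu=\sup_{x\in V}\frac{\deg(x)}{\mu(x)}<\infty,\quad d=\sup_{x\in V,\,y\sim x}\frac{\mu(x)}{w_{xy}}<\infty,\quad \mu_{\max}=\sup_{x\in V}\mu(x)<\infty,\quad w_{\min}=\inf_{x\in V,\,y\sim x}w_{xy}>0.$$ Let $\lambda^*$ be the greatest lower bound of the spectrum of $-\Delta$ on $\ell^2(V,\mu)$, and let $P_t(x,y)$ be the minimal heat kernel of $G$ with respect to $\mu$, i.e. the increasing limit, over the finite sets $U\subset V$, of the Dirichlet heat kernels $p^U_t(x,y)=\frac{1}{\mu(y)}\bigl(e^{t\Delta_U}\bigr)_{xy}$. Let $\mathrm{dist}$ be the combinatorial graph distance ($\infty$ between different components), $B_x(r)=\{y:\mathrm{dist}(x,y)\le r\}$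 and $\mathrm{Vol}(A)=\sum_{y\in A}\mu(y)$. Then for any $\epsilon>0$, $0<\gamma\le1$ and $\beta>0$ there exist positive constants $C_1=C_1(\beta,\gamma,D_\mu)$ and $C_2=C_2(\epsilon,\beta,\gamma,D_\mu,d,\mu_{\max},w_{\min})$ such that for all $x,y\in V$ and all $t\ge\max\{\beta\,\mathrm{dist}(x,y),1\}$, $$P_t(x,y)\le\frac{\exp\left(-(1-\gamma)\lambda^*t\right)}{\sqrt{\mathrm{Vol}(B_x(\sqrt t))\,\mathrm{Vol}(B_y(\sqrt t))}}\exp\left\{C_2\sqrt t-C_1\frac{\mathrm{dist}(x,y)^2}{4(1+2\epsilon)t}\right\}.$$ -/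

import Mathlib

open scoped ENNReal

universe u

noncomputable section

/-- A locally finite weighted graph (finite graphs included): a simple graph on `V` in which every
vertex has finitely many neighbours, a symmetric positive weight `w x y` on every edge, and a
positive measure `μ` on the vertices.  The values of `w` off the edges are never used. -/
structure WeightedGraph (V : Type u) where
  /-- the edge relation -/
  graph : SimpleGraph V
  finite_neighborSet : ∀ x, (graph.neighborSet x).Finite
  /-- the edge weights -/
  w : V → V → ℝ
  w_pos : ∀ x y, graph.Adj x y → 0 < w x y
  w_symm : ∀ x y, graph.Adj x y → w x y = w y x
  /-- the measure of a vertex -/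
  μ : V → ℝ
  μ_pos : ∀ x, 0 < μ x

namespace WeightedGraph

variable {V : Type u} (G : WeightedGraph V)

/-- The finite set of neighbours of `x`. -/
def nbrs (x : V) : Finset V := (G.finite_neighborSet x).toFinset

/-- The weighted degree `deg x = ∑_{y ∼ x} w x y`. -/
def deg (x : V) : ℝ := ∑ y ∈ G.nbrs x, G.w x y

/-- The `μ`-Laplacian `Δ f (x) = μ(x)⁻¹ ∑_{y ∼ x} w x y (f y - f x)`. -/
def lap (f : V → ℂ) (x : V) : ℂ :=
  (1 / (G.μ x : ℂ)) * ∑ y ∈ G.nbrs x, (G.w x y : ℂ) * (f y - f x)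

/-- `D_μ = sup_x deg x / μ x`, as an extended nonnegative number. -/
def Dmu : ℝ≥0∞ := ⨆ x, ENNReal.ofReal (G.deg x / G.μ x)

/-- `d = sup_{x ∼ y} μ x / w x y`, as an extended nonnegative number. -/
def dsup : ℝ≥0∞ := ⨆ (x : V) (y : V) (_ : G.graph.Adj x y), ENNReal.ofReal (G.μ x / G.w x y)

/-- `μ_max = sup_x μ x`, as an extended nonnegative number. -/
def muMax : ℝ≥0∞ := ⨆ x, ENNReal.ofReal (G.μ x)

/-- `w_min = inf_{x ∼ y} w x y`, as an extended nonnegative number (`∞` if there are no edges). -/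
def wMin : ℝ≥0∞ := ⨅ (x : V) (y : V) (_ : G.graph.Adj x y), ENNReal.ofReal (G.w x y)

/-- The closed ball `B_x(r) = {y : dist x y ≤ r}` for the combinatorial distance; vertices in
another component are at infinite distance. -/
def ball (x : V) (r : ℝ) : Set V := {y | G.graph.Reachable x y ∧ (G.graph.dist x y : ℝ) ≤ r}

/-- `Vol B_x(r) = ∑_{y ∈ B_x(r)} μ y`; the ball is a finite set since the graph is locally
finite. -/
def vol (x : V) (r : ℝ) : ℝ := ∑ᶠ y ∈ G.ball x r, G.μ y

/-! ### The minimal heat kernel -/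

open Classical in
/-- The Laplacian with Dirichlet boundary condition on a finite set `U` of vertices, as a matrix:
`(Δ_U f)(x) = (Δ f)(x)` for `x ∈ U` and `f` vanishing outside `U`. -/
def dirichletLap (U : Finset V) : Matrix U U ℝ := fun x y =>
  ((if G.graph.Adj x y then G.w x y else 0) - (if x = y then G.deg x else 0)) / G.μ x

open Classical in
/-- The Dirichlet heat kernel of `U` with respect to `μ`, namely
`p^U_t(x,y) = (exp (t Δ_U))_{x y} / μ y`, extended by zero outside `U × U`. -/
def dirichletHeatKernel (U : Finset V) (t : ℝ) (x y : V) : ℝ :=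
  if h : x ∈ U ∧ y ∈ U then
    NormedSpace.exp (t • G.dirichletLap U) ⟨x, h.1⟩ ⟨y, h.2⟩ / G.μ y
  else 0

/-- The minimal heat kernel `P_t(x,y)`: the increasing limit of the Dirichlet heat kernels along
the finite subsets of `V`. -/
def heatKernel (t : ℝ) (x y : V) : ℝ := ⨆ U : Finset V, G.dirichletHeatKernel U t x y

/-! ### The Laplacian on `ℓ²(V, μ)` and the bottom of its spectrum -/

/-- The square-summable functions, as a subspace of all functions. -/
def l2Submodule : Submodule ℂ (V → ℂ) where
  carrier := {f | Summable fun x => G.μ x * ‖f x‖ ^ 2}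
  zero_mem' := by simp
  add_mem' := by
    intro f g hf hg
    refine Summable.of_nonneg_of_le (fun x => mul_nonneg (G.μ_pos x).le (sq_nonneg _)) (fun x => ?_)
      ((hf.add hg).mul_left 2)
    have h1 : ‖f x + g x‖ ^ 2 ≤ 2 * (‖f x‖ ^ 2 + ‖g x‖ ^ 2) := by
      nlinarith [norm_add_le (f x) (g x), norm_nonneg (f x + g x), sq_nonneg (‖f x‖ - ‖g x‖)]
    have h2 := mul_le_mul_of_nonneg_left h1 (G.μ_pos x).le
    simp only [Pi.add_apply]
    linarith
  smul_mem' := by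
    intro c f hf
    refine (hf.mul_left (‖c‖ ^ 2)).congr (fun x => ?_)
    simp only [Pi.smul_apply, norm_smul]
    ring

/-- The space `ℓ²(V, μ)` of complex functions `f` with `∑ μ x |f x|² < ∞`. -/
def L2 : Type u := ↥G.l2Submodule

instance : AddCommGroup G.L2 := inferInstanceAs (AddCommGroup ↥G.l2Submodule)

instance : Module ℂ G.L2 := inferInstanceAs (Module ℂ ↥G.l2Submodule)

/-- The inclusion of `ℓ²(V, μ)` in the functions on `V`. -/
def L2.toFun : G.L2 →ₗ[ℂ] (V → ℂ) := G.l2Submodule.subtype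

/-- Multiplication by `√μ`, from `ℓ²(V, μ)` to the unweighted `ℓ²(V)`. -/
def L2.toLp : G.L2 →ₗ[ℂ] lp (fun _ : V => ℂ) 2 where
  toFun f := ⟨fun x => (Real.sqrt (G.μ x) : ℂ) * L2.toFun G f x, by
    refine memℓp_gen ?_
    refine Summable.congr f.2 (fun x => ?_)
    simp only [ENNReal.toReal_ofNat, Real.rpow_ofNat, norm_mul, mul_pow, Complex.norm_real,
      Real.norm_eq_abs, sq_abs, Real.sq_sqrt (G.μ_pos x).le]
    rfl⟩
  map_add' f g := by
    ext x
    change (Real.sqrt (G.μ x) : ℂ) * L2.toFun G (f + g) x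
      = (Real.sqrt (G.μ x) : ℂ) * L2.toFun G f x + (Real.sqrt (G.μ x) : ℂ) * L2.toFun G g x
    simp [mul_add]
  map_smul' c f := by
    ext x
    simp [mul_left_comm]

theorem L2.toLp_injective : Function.Injective (L2.toLp G) := by
  intro f g h
  apply Subtype.ext
  funext x
  have hx : (Real.sqrt (G.μ x) : ℂ) * L2.toFun G f x = (Real.sqrt (G.μ x) : ℂ) * L2.toFun G g x :=
    congrFun (congrArg (fun k : lp (fun _ : V => ℂ) 2 => (k : V → ℂ)) h) x
  exact mul_left_cancel₀
    (Complex.ofReal_ne_zero.2 (Real.sqrt_pos.2 (G.μ_pos x)).ne') hx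

/-- The norm of `ℓ²(V, μ)`. -/
instance : NormedAddCommGroup G.L2 :=
  NormedAddCommGroup.induced G.L2 (lp (fun _ : V => ℂ) 2) (L2.toLp G) (L2.toLp_injective G)

instance : NormedSpace ℂ G.L2 := NormedSpace.induced ℂ G.L2 (lp (fun _ : V => ℂ) 2) (L2.toLp G)

theorem L2.summable (f : G.L2) : Summable fun x => G.μ x * ‖L2.toFun G f x‖ ^ 2 := f.2

theorem L2.norm_sq (f : G.L2) : ‖f‖ ^ 2 = ∑' x, G.μ x * ‖L2.toFun G f x‖ ^ 2 := by
  have h : ‖f‖ = ‖L2.toLp G f‖ := rfl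
  have h2 := lp.norm_rpow_eq_tsum (p := 2) (by norm_num) (L2.toLp G f)
  simp only [ENNReal.toReal_ofNat, Real.rpow_ofNat] at h2
  rw [h, h2]
  refine tsum_congr (fun x => ?_)
  change ‖(Real.sqrt (G.μ x) : ℂ) * L2.toFun G f x‖ ^ 2 = _
  simp only [norm_mul, mul_pow, Complex.norm_real, Real.norm_eq_abs, sq_abs,
    Real.sq_sqrt (G.μ_pos x).le]

theorem mem_nbrs {x y : V} : y ∈ G.nbrs x ↔ G.graph.Adj x y := by
  simp [nbrs]

theorem deg_nonneg (x : V) : 0 ≤ G.deg x :=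
  Finset.sum_nonneg fun y hy => (G.w_pos x y (G.mem_nbrs.1 hy)).le

theorem deg_le (hD : G.Dmu < ⊤) (x : V) : G.deg x ≤ G.Dmu.toReal * G.μ x := by
  have h : ENNReal.ofReal (G.deg x / G.μ x) ≤ G.Dmu :=
    le_iSup (fun x => ENNReal.ofReal (G.deg x / G.μ x)) x
  exact (div_le_iff₀ (G.μ_pos x)).1 ((ENNReal.ofReal_le_iff_le_toReal hD.ne).1 h)

/-- Pointwise bound on the Laplacian. -/
theorem lap_sq_le (hD : G.Dmu < ⊤) (f : V → ℂ) (x : V) :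
    G.μ x * ‖G.lap f x‖ ^ 2 ≤ 2 * G.Dmu.toReal * (∑ y ∈ G.nbrs x, G.w x y * ‖f y‖ ^ 2)
      + 2 * G.Dmu.toReal ^ 2 * (G.μ x * ‖f x‖ ^ 2) := by
  have hμ := G.μ_pos x
  have hw : ∀ y ∈ G.nbrs x, 0 ≤ G.w x y := fun y hy => (G.w_pos x y (G.mem_nbrs.1 hy)).le
  set D := G.Dmu.toReal
  have hD0 : 0 ≤ D := ENNReal.toReal_nonneg
  set S := ∑ y ∈ G.nbrs x, G.w x y * ‖f y‖ ^ 2 with hS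
  have hS0 : 0 ≤ S := Finset.sum_nonneg fun y hy => mul_nonneg (hw y hy) (sq_nonneg _)
  have h1 : ‖∑ y ∈ G.nbrs x, (G.w x y : ℂ) * (f y - f x)‖
      ≤ ∑ y ∈ G.nbrs x, G.w x y * ‖f y - f x‖ := by
    refine (norm_sum_le _ _).trans (le_of_eq (Finset.sum_congr rfl fun y hy => ?_))
    rw [norm_mul, Complex.norm_real, Real.norm_of_nonneg (hw y hy)]
  have h2 : (∑ y ∈ G.nbrs x, G.w x y * ‖f y - f x‖) ^ 2
      ≤ G.deg x * ∑ y ∈ G.nbrs x, G.w x y * ‖f y - f x‖ ^ 2 := by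
    refine Finset.sum_sq_le_sum_mul_sum_of_sq_le_mul _ hw
      (fun y hy => mul_nonneg (hw y hy) (sq_nonneg _)) (fun y _ => le_of_eq (by ring))
  have h3 : ∑ y ∈ G.nbrs x, G.w x y * ‖f y - f x‖ ^ 2 ≤ 2 * S + 2 * (G.deg x * ‖f x‖ ^ 2) := by
    rw [hS, deg, Finset.sum_mul, Finset.mul_sum, Finset.mul_sum, ← Finset.sum_add_distrib]
    refine Finset.sum_le_sum fun y hy => ?_
    have : ‖f y - f x‖ ^ 2 ≤ 2 * ‖f y‖ ^ 2 + 2 * ‖f x‖ ^ 2 := by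
      nlinarith [norm_sub_le (f y) (f x), norm_nonneg (f y - f x), sq_nonneg (‖f y‖ - ‖f x‖)]
    nlinarith [mul_le_mul_of_nonneg_left this (hw y hy)]
  have h4 : ‖∑ y ∈ G.nbrs x, (G.w x y : ℂ) * (f y - f x)‖ ^ 2
      ≤ G.deg x * (2 * S + 2 * (G.deg x * ‖f x‖ ^ 2)) :=
    ((pow_le_pow_left₀ (norm_nonneg _) h1 2).trans h2).trans
      (mul_le_mul_of_nonneg_left h3 (G.deg_nonneg x))
  have h5 : G.deg x * (2 * S + 2 * (G.deg x * ‖f x‖ ^ 2))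
      ≤ (D * G.μ x) * (2 * S + 2 * ((D * G.μ x) * ‖f x‖ ^ 2)) := by
    have hd := G.deg_le hD x
    have := G.deg_nonneg x
    gcongr
  have h6 : G.μ x * ‖G.lap f x‖ ^ 2
      = (1 / G.μ x) * ‖∑ y ∈ G.nbrs x, (G.w x y : ℂ) * (f y - f x)‖ ^ 2 := by
    rw [lap, norm_mul, norm_div, norm_one, Complex.norm_real, Real.norm_of_nonneg hμ.le]
    field_simp
  rw [h6]
  calc _ ≤ (1 / G.μ x) * ((D * G.μ x) * (2 * S + 2 * ((D * G.μ x) * ‖f x‖ ^ 2))) :=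
        mul_le_mul_of_nonneg_left (h4.trans h5) (by positivity)
    _ = _ := by field_simp

/-- The double sum `∑_x ∑_{y ∼ x} w x y |f y|²` is at most `D_μ ∑_y μ y |f y|²`. -/
theorem hasSum_nbrs (hD : G.Dmu < ⊤) (f : V → ℂ) (hf : Summable fun x => G.μ x * ‖f x‖ ^ 2) :
    Summable (fun x => ∑ y ∈ G.nbrs x, G.w x y * ‖f y‖ ^ 2) ∧
      ∑' x, ∑ y ∈ G.nbrs x, G.w x y * ‖f y‖ ^ 2 ≤ G.Dmu.toReal * ∑' x, G.μ x * ‖f x‖ ^ 2 := by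
  classical
  have hnn : ∀ x, 0 ≤ G.μ x * ‖f x‖ ^ 2 := fun x => mul_nonneg (G.μ_pos x).le (sq_nonneg _)
  have hF : ∀ x, 0 ≤ ∑ y ∈ G.nbrs x, G.w x y * ‖f y‖ ^ 2 := fun x =>
    Finset.sum_nonneg fun y hy => mul_nonneg (G.w_pos x y (G.mem_nbrs.1 hy)).le (sq_nonneg _)
  have key : ∀ s : Finset V, ∑ x ∈ s, ∑ y ∈ G.nbrs x, G.w x y * ‖f y‖ ^ 2
      ≤ G.Dmu.toReal * ∑' x, G.μ x * ‖f x‖ ^ 2 := by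
    intro s
    have hcomm : ∑ x ∈ s, ∑ y ∈ G.nbrs x, G.w x y * ‖f y‖ ^ 2
        = ∑ y ∈ s.biUnion G.nbrs, ∑ x ∈ s with x ∈ G.nbrs y, G.w x y * ‖f y‖ ^ 2 := by
      refine Finset.sum_comm' fun x y => ?_
      simp only [Finset.mem_filter, Finset.mem_biUnion, mem_nbrs]
      constructor
      · rintro ⟨hx, hxy⟩
        exact ⟨⟨hx, hxy.symm⟩, x, hx, hxy⟩
      · rintro ⟨⟨hx, hxy⟩, -⟩
        exact ⟨hx, hxy.symm⟩
    have hle : ∀ y, ∑ x ∈ s with x ∈ G.nbrs y, G.w x y * ‖f y‖ ^ 2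
        ≤ G.Dmu.toReal * (G.μ y * ‖f y‖ ^ 2) := by
      intro y
      rw [← Finset.sum_mul, ← mul_assoc]
      refine mul_le_mul_of_nonneg_right (le_trans ?_ (G.deg_le hD y)) (sq_nonneg _)
      rw [deg]
      calc ∑ x ∈ s with x ∈ G.nbrs y, G.w x y = ∑ x ∈ s with x ∈ G.nbrs y, G.w y x :=
            Finset.sum_congr rfl fun x hx =>
              (G.w_symm y x (G.mem_nbrs.1 (Finset.mem_filter.1 hx).2)).symm
        _ ≤ _ := Finset.sum_le_sum_of_subset_of_nonneg
              (fun x hx => (Finset.mem_filter.1 hx).2)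
              (fun x hx _ => (G.w_pos y x (G.mem_nbrs.1 hx)).le)
    rw [hcomm]
    refine (Finset.sum_le_sum fun y _ => hle y).trans ?_
    rw [← Finset.mul_sum]
    exact mul_le_mul_of_nonneg_left (hf.sum_le_tsum _ fun y _ => hnn y) ENNReal.toReal_nonneg
  have hs : Summable (fun x => ∑ y ∈ G.nbrs x, G.w x y * ‖f y‖ ^ 2) :=
    summable_of_sum_le hF key
  exact ⟨hs, hs.tsum_le_of_sum_le key⟩

theorem summable_lap (hD : G.Dmu < ⊤) (f : V → ℂ) (hf : Summable fun x => G.μ x * ‖f x‖ ^ 2) :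
    Summable fun x => G.μ x * ‖G.lap f x‖ ^ 2 :=
  Summable.of_nonneg_of_le (fun x => mul_nonneg (G.μ_pos x).le (sq_nonneg _)) (G.lap_sq_le hD f)
    (((G.hasSum_nbrs hD f hf).1.mul_left _).add (hf.mul_left _))

/-- The Laplacian as a linear map of `ℓ²(V, μ)`. -/
def lapL2Linear (hD : G.Dmu < ⊤) : G.L2 →ₗ[ℂ] G.L2 where
  toFun f := ⟨G.lap (L2.toFun G f), G.summable_lap hD _ (L2.summable G f)⟩
  map_add' f g := by
    apply Subtype.ext
    funext x
    change G.lap (L2.toFun G (f + g)) x = G.lap (L2.toFun G f) x + G.lap (L2.toFun G g) x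
    simp only [lap, map_add, Pi.add_apply, ← mul_add, ← Finset.sum_add_distrib]
    congr 1
    exact Finset.sum_congr rfl fun y _ => by ring
  map_smul' c f := by
    apply Subtype.ext
    funext x
    change G.lap (L2.toFun G (c • f)) x = c * G.lap (L2.toFun G f) x
    simp only [lap, map_smul, Pi.smul_apply, smul_eq_mul, mul_left_comm c, Finset.mul_sum]
    exact Finset.sum_congr rfl fun y _ => by ring

/-- For `D_μ < ∞` the Laplacian is a bounded operator on `ℓ²(V, μ)`. -/
def lapL2 (hD : G.Dmu < ⊤) : G.L2 →L[ℂ] G.L2 :=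
  (G.lapL2Linear hD).mkContinuous (2 * G.Dmu.toReal) (fun f => by
    have hD0 : 0 ≤ G.Dmu.toReal := ENNReal.toReal_nonneg
    refine (sq_le_sq₀ (norm_nonneg _) (by positivity)).1 ?_
    have hf := L2.summable G f
    obtain ⟨hs, hle⟩ := G.hasSum_nbrs hD _ hf
    rw [mul_pow, L2.norm_sq, L2.norm_sq]
    change ∑' x, G.μ x * ‖G.lap (L2.toFun G f) x‖ ^ 2 ≤ _
    refine ((G.summable_lap hD _ hf).tsum_le_tsum (G.lap_sq_le hD _)
      ((hs.mul_left _).add (hf.mul_left _))).trans ?_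
    rw [(hs.mul_left _).tsum_add (hf.mul_left _), tsum_mul_left, tsum_mul_left]
    nlinarith [mul_le_mul_of_nonneg_left hle hD0])

/-- `λ*`, the greatest lower bound of the spectrum of `-Δ` on `ℓ²(V, μ)` (a set of nonnegative real
numbers). -/
def lambdaStar (hD : G.Dmu < ⊤) : ℝ := sInf {r : ℝ | (r : ℂ) ∈ spectrum ℂ (-G.lapL2 hD)}

end WeightedGraph

end

noncomputable section

/-! ### Spectral lower bounds on a Hilbert space -/

section Hilbert

open scoped InnerProductSpace

variable {H : Type*} [NormedAddCommGroup H] [InnerProductSpace ℂ H] [CompleteSpace H]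
  {T : H →L[ℂ] H}

/-! The argument is Davies' exponential perturbation method. For a 1-Lipschitz `φ` and a slope `a`,
let `g(s)` be the squared `ℓ²(μ)` norm of `e^{aφ}` times the column at `y` of `e^{sΔ_U}`. The weight
changes the Dirichlet form by at most `(cosh a - 1) ∑ deg v²` (`energy_sub_le_weighted`), while the
form itself is at least `λ* ‖v‖²` (`lambdaStar_mul_le_energy`), so `g' ≤ -2(λ* - D_μ(cosh a - 1))
g`. Integrating and keeping only the term of `g(t)` at `x` bounds `p^U_t(x,y)` by an exponential
over `√(μ(x)μ(y))`, uniformly in `U` (`weighted_dirichletHeatKernel_le`).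

With `φ = dist(y,·)` and `a` proportional to `dist(x,y)/t`, which stays bounded because `t ≥ β
dist(x,y)`, the exponent becomes Gaussian (`exists_slope`). Finally, volumes grow at most
exponentially in the radius, so replacing `μ(x)` and `μ(y)` by the volumes of balls of radius `√t`
costs only a factor `e^{C√t}` (`vol_le`). -/

theorem spectrum_nonneg_of_isPositive (hT : T.IsPositive) {r : ℝ} (hr : (r : ℂ) ∈ spectrum ℂ T) :
    0 ≤ r :=
  spectrum_nonneg_of_nonneg ((ContinuousLinearMap.nonneg_iff_isPositive T).2 hT)
    (spectrum.algebraMap_mem_iff ℂ |>.1 hr)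

/-- By the functional calculus, a self-adjoint operator with spectrum in `[c, ∞)` dominates `c • 1`
in the Loewner order; the claim is this inequality evaluated at `f`. -/
theorem mul_norm_sq_le_re_inner (hT : IsSelfAdjoint T) {c : ℝ}
    (hc : ∀ r : ℝ, (r : ℂ) ∈ spectrum ℂ T → c ≤ r) (f : H) :
    c * ‖f‖ ^ 2 ≤ (⟪T f, f⟫_ℂ).re := by
  have hle : algebraMap ℝ (H →L[ℂ] H) c ≤ T :=
    (algebraMap_le_iff_le_spectrum hT).2 fun r hr => hc r (spectrum.algebraMap_mem ℂ hr)
  have h := ((ContinuousLinearMap.le_def _ _).1 hle).re_inner_nonneg_left f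
  have h2 : (⟪algebraMap ℝ (H →L[ℂ] H) c f, f⟫_ℂ).re = c * ‖f‖ ^ 2 := by
    rw [← inner_self_eq_norm_sq (𝕜 := ℂ), RCLike.re_eq_complex_re, ← Complex.re_ofReal_mul,
      ← Complex.conj_ofReal, ← inner_smul_left]
    rfl
  rw [sub_apply, inner_sub_left, map_sub, RCLike.re_eq_complex_re, h2] at h
  linarith

end Hilbert

namespace WeightedGraph

variable {V : Type u} (G : WeightedGraph V)

open scoped InnerProductSpace ComplexConjugate

/-! ### Dirichlet energy of finitely supported functions -/

open Classical in
/-- The edge weight, extended by zero to the pairs that are not edges. -/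
def edgeWeight (x y : V) : ℝ := if G.graph.Adj x y then G.w x y else 0

theorem edgeWeight_nonneg (x y : V) : 0 ≤ G.edgeWeight x y := by
  unfold edgeWeight
  split_ifs with h
  exacts [(G.w_pos x y h).le, le_rfl]

theorem edgeWeight_comm (x y : V) : G.edgeWeight x y = G.edgeWeight y x := by
  unfold edgeWeight
  by_cases h : G.graph.Adj x y
  · rw [if_pos h, if_pos h.symm, G.w_symm x y h]
  · rw [if_neg h, if_neg fun h' => h h'.symm]

theorem sum_edgeWeight_le_deg (s : Finset V) (x : V) : ∑ y ∈ s, G.edgeWeight x y ≤ G.deg x := by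
  classical
  unfold edgeWeight deg
  rw [← Finset.sum_filter]
  exact Finset.sum_le_sum_of_subset_of_nonneg
    (fun y hy => G.mem_nbrs.2 (Finset.mem_filter.1 hy).2)
    fun y hy _ => (G.w_pos x y (G.mem_nbrs.1 hy)).le

/-- The Dirichlet energy of the extension by zero of `v` from the finite set `s`. -/
def energy (s : Finset V) (v : V → ℝ) : ℝ :=
  ∑ x ∈ s, G.deg x * v x ^ 2 - ∑ x ∈ s, ∑ y ∈ s, G.edgeWeight x y * (v x * v y)

/-- AM-GM on each product; by symmetry of the weights both squares give the same sum, and row sums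
are at most `deg`. The absolute values matter later, when the perturbation error in Davies' estimate
is bounded. -/
theorem sum_edgeWeight_mul_le (s : Finset V) (v : V → ℝ) :
    ∑ x ∈ s, ∑ y ∈ s, G.edgeWeight x y * |v x * v y| ≤ ∑ x ∈ s, G.deg x * v x ^ 2 := by
  have h1 : ∑ x ∈ s, ∑ y ∈ s, G.edgeWeight x y * v x ^ 2 ≤ ∑ x ∈ s, G.deg x * v x ^ 2 := by
    refine Finset.sum_le_sum fun x _ => ?_
    rw [← Finset.sum_mul]
    exact mul_le_mul_of_nonneg_right (G.sum_edgeWeight_le_deg s x) (sq_nonneg _)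
  have h2 : ∑ x ∈ s, ∑ y ∈ s, G.edgeWeight x y * v y ^ 2
      = ∑ x ∈ s, ∑ y ∈ s, G.edgeWeight x y * v x ^ 2 := by
    rw [Finset.sum_comm]
    refine Finset.sum_congr rfl fun x _ => Finset.sum_congr rfl fun y _ => ?_
    rw [G.edgeWeight_comm]
  have h3 : ∑ x ∈ s, ∑ y ∈ s, G.edgeWeight x y * |v x * v y|
      ≤ ∑ x ∈ s, ∑ y ∈ s, (G.edgeWeight x y * v x ^ 2 + G.edgeWeight x y * v y ^ 2) / 2 := by
    refine Finset.sum_le_sum fun x _ => Finset.sum_le_sum fun y _ => ?_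
    have : |v x * v y| ≤ (v x ^ 2 + v y ^ 2) / 2 :=
      abs_le.2 ⟨by nlinarith [sq_nonneg (v x + v y)], by nlinarith [sq_nonneg (v x - v y)]⟩
    nlinarith [mul_le_mul_of_nonneg_left this (G.edgeWeight_nonneg x y)]
  simp only [← Finset.sum_div, Finset.sum_add_distrib] at h3
  linarith

theorem energy_nonneg (s : Finset V) (v : V → ℝ) : 0 ≤ G.energy s v := by
  have h : ∑ x ∈ s, ∑ y ∈ s, G.edgeWeight x y * (v x * v y)
      ≤ ∑ x ∈ s, ∑ y ∈ s, G.edgeWeight x y * |v x * v y| :=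
    Finset.sum_le_sum fun x _ => Finset.sum_le_sum fun y _ =>
      mul_le_mul_of_nonneg_left (le_abs_self _) (G.edgeWeight_nonneg x y)
  have := G.sum_edgeWeight_mul_le s v
  unfold energy
  linarith

/-! ### The operator `-Δ` on the unweighted `ℓ²(V)` and the variational bound for `λ*` -/

/-- Multiplication by `√μ` is a unitary map from `ℓ²(V, μ)` onto `ℓ²(V)`. -/
def L2.lpEquiv : G.L2 ≃ₗᵢ[ℂ] lp (fun _ : V => ℂ) 2 :=
  LinearIsometryEquiv.ofSurjective ⟨L2.toLp G, fun _ => rfl⟩ (by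
    intro g
    have hs : Summable fun x => G.μ x * ‖((Real.sqrt (G.μ x) : ℂ))⁻¹ * g x‖ ^ 2 := by
      have hg : Summable fun x => ‖g x‖ ^ 2 := by
        simpa using (lp.memℓp g).summable (by norm_num)
      refine hg.congr fun x => ?_
      rw [norm_mul, norm_inv, Complex.norm_real, Real.norm_of_nonneg (Real.sqrt_nonneg _), mul_pow,
        inv_pow, Real.sq_sqrt (G.μ_pos x).le, mul_inv_cancel_left₀ (G.μ_pos x).ne']
    refine ⟨⟨fun x => ((Real.sqrt (G.μ x) : ℂ))⁻¹ * g x, hs⟩, ?_⟩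
    ext x
    exact mul_inv_cancel_left₀ (Complex.ofReal_ne_zero.2 (Real.sqrt_pos.2 (G.μ_pos x)).ne') _)

theorem L2.lpEquiv_apply (f : G.L2) (x : V) :
    L2.lpEquiv G f x = (Real.sqrt (G.μ x) : ℂ) * L2.toFun G f x := rfl

/-- The operator `-Δ`, transported to the unweighted `ℓ²(V)`. -/
def lpNegLap (hD : G.Dmu < ⊤) : lp (fun _ : V => ℂ) 2 →L[ℂ] lp (fun _ : V => ℂ) 2 :=
  (L2.lpEquiv G).toContinuousLinearEquiv.conjContinuousAlgEquiv (-G.lapL2 hD)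

theorem spectrum_lpNegLap (hD : G.Dmu < ⊤) :
    spectrum ℂ (G.lpNegLap hD) = spectrum ℂ (-G.lapL2 hD) :=
  AlgEquiv.spectrum_eq (R := ℂ)
    (L2.lpEquiv G).toContinuousLinearEquiv.conjContinuousAlgEquiv (-G.lapL2 hD)

theorem lpNegLap_lpEquiv (hD : G.Dmu < ⊤) (f : G.L2) (x : V) :
    G.lpNegLap hD (L2.lpEquiv G f) x = -((Real.sqrt (G.μ x) : ℂ) * G.lap (L2.toFun G f) x) := by
  have h : G.lpNegLap hD (L2.lpEquiv G f) = L2.lpEquiv G (-(G.lapL2 hD f)) := by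
    change L2.lpEquiv G (-(G.lapL2 hD ((L2.lpEquiv G).symm (L2.lpEquiv G f)))) = _
    rw [LinearIsometryEquiv.symm_apply_apply]
  rw [h, map_neg]
  rfl

open Classical in
/-- The matrix of `-Δ` in the orthonormal basis `δ_x / √μ(x)`. -/
def negLapEntry (x y : V) : ℝ :=
  ((if x = y then G.deg x else 0) - G.edgeWeight x y) / (Real.sqrt (G.μ x) * Real.sqrt (G.μ y))

theorem negLapEntry_comm (x y : V) : G.negLapEntry x y = G.negLapEntry y x := by
  unfold negLapEntry
  rw [G.edgeWeight_comm x y, mul_comm (Real.sqrt (G.μ x))]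
  by_cases h : x = y
  · subst h; rfl
  · rw [if_neg h, if_neg (Ne.symm h)]

open Classical in
theorem lap_single (a : ℂ) (x y : V) :
    G.lap (Pi.single y a) x
      = (1 / (G.μ x : ℂ)) * ((G.edgeWeight x y - if x = y then G.deg x else 0 : ℝ) * a) := by
  unfold lap
  congr 1
  simp only [mul_sub, Finset.sum_sub_distrib, ← Finset.sum_mul]
  have h1 : ∑ z ∈ G.nbrs x, (G.w x z : ℂ) * (Pi.single y a : V → ℂ) z = G.edgeWeight x y * a := by
    simp only [Pi.single_apply, mul_ite, mul_zero, Finset.sum_ite_eq', mem_nbrs, edgeWeight]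
    split_ifs <;> simp
  rw [h1, Pi.single_apply]
  split_ifs with h <;> simp [deg, sub_mul]

open Classical in
theorem lpNegLap_single (hD : G.Dmu < ⊤) (x y : V) (c : ℂ) :
    G.lpNegLap hD (lp.single 2 y c) x = G.negLapEntry x y * c := by
  obtain ⟨f, hf⟩ := (L2.lpEquiv G).surjective (lp.single 2 y c)
  have hpos : ∀ z, (Real.sqrt (G.μ z) : ℂ) ≠ 0 := fun z =>
    Complex.ofReal_ne_zero.2 (Real.sqrt_pos.2 (G.μ_pos z)).ne'
  have hfun : L2.toFun G f = Pi.single y ((Real.sqrt (G.μ y) : ℂ)⁻¹ * c) := by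
    funext z
    have hz := congrArg (fun k : lp (fun _ : V => ℂ) 2 => k z) hf
    simp only [L2.lpEquiv_apply, lp.single_apply] at hz
    refine mul_left_cancel₀ (hpos z) (hz.trans ?_)
    by_cases h : z = y
    · subst h
      simp [hpos z]
    · simp [h]
  have hsq : (G.μ x : ℂ) = (Real.sqrt (G.μ x) : ℂ) * (Real.sqrt (G.μ x) : ℂ) := by
    rw [← Complex.ofReal_mul, Real.mul_self_sqrt (G.μ_pos x).le]
  rw [← hf, lpNegLap_lpEquiv, hfun, lap_single, negLapEntry, hsq]
  have := hpos x
  have := hpos y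
  push_cast
  field_simp
  ring

open Classical in
theorem inner_lpNegLap_sum (hD : G.Dmu < ⊤) (s : Finset V) (c : V → ℂ) :
    ⟪G.lpNegLap hD (∑ x ∈ s, lp.single 2 x (c x)), ∑ x ∈ s, lp.single 2 x (c x)⟫_ℂ
      = ∑ x ∈ s, ∑ y ∈ s, G.negLapEntry x y * (conj (c x) * c y) := by
  rw [inner_sum, Finset.sum_comm]
  refine Finset.sum_congr rfl fun y _ => ?_
  rw [lp.inner_single_right, map_sum, lp.coeFn_sum, Finset.sum_apply, sum_inner]
  refine Finset.sum_congr rfl fun x _ => ?_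
  rw [lpNegLap_single, G.negLapEntry_comm y x]
  simp
  ring

/-- Bounded operators on `ℓ²(V)` are determined by their matrix entries, and this matrix is real and
symmetric. -/
theorem isSelfAdjoint_lpNegLap (hD : G.Dmu < ⊤) : IsSelfAdjoint (G.lpNegLap hD) := by
  classical
  rw [ContinuousLinearMap.isSelfAdjoint_iff']
  refine lp.ext_continuousLinearMap (by norm_num) fun x => ?_
  refine ContinuousLinearMap.ext fun c => lp.ext (funext fun y => ?_)
  have h := ContinuousLinearMap.adjoint_inner_right (G.lpNegLap hD)
    (lp.single 2 y (1 : ℂ)) (lp.single 2 x c)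
  rw [lp.inner_single_left, lp.inner_single_right, lpNegLap_single] at h
  simp at h
  change (ContinuousLinearMap.adjoint (G.lpNegLap hD)) (lp.single 2 x c) y
    = G.lpNegLap hD (lp.single 2 x c) y
  rw [h, lpNegLap_single, G.negLapEntry_comm, mul_comm]

theorem sum_negLapEntry_mul (s : Finset V) (c : V → ℝ) :
    ∑ x ∈ s, ∑ y ∈ s, G.negLapEntry x y * (c x * c y)
      = G.energy s fun x => c x / Real.sqrt (G.μ x) := by
  classical
  unfold energy negLapEntry
  rw [← Finset.sum_sub_distrib]
  refine Finset.sum_congr rfl fun x hx => ?_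
  have h : ∀ y, ((if x = y then G.deg x else 0) - G.edgeWeight x y)
        / (Real.sqrt (G.μ x) * Real.sqrt (G.μ y)) * (c x * c y)
      = (if x = y then G.deg x * (c x / Real.sqrt (G.μ x)) ^ 2 else 0)
        - G.edgeWeight x y * (c x / Real.sqrt (G.μ x) * (c y / Real.sqrt (G.μ y))) := by
    intro y
    split_ifs with h
    · subst h; ring
    · ring
  simp only [h, Finset.sum_sub_distrib, Finset.sum_ite_eq, if_pos hx]

/-- By continuity it suffices to treat finite truncations of `f`. Off-diagonal entries are
nonpositive, so passing from `f` to `‖f‖` can only lower the form, and the real energy is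
nonnegative. -/
theorem re_inner_lpNegLap_nonneg (hD : G.Dmu < ⊤) (f : lp (fun _ : V => ℂ) 2) :
    0 ≤ (⟪G.lpNegLap hD f, f⟫_ℂ).re := by
  classical
  have hf : HasSum (fun i : V => lp.single 2 i (f i)) f := lp.hasSum_single ENNReal.ofNat_ne_top f
  have hcont : Continuous fun g : lp (fun _ : V => ℂ) 2 => (⟪G.lpNegLap hD g, g⟫_ℂ).re := by
    fun_prop
  refine ge_of_tendsto ((hcont.tendsto f).comp hf) (Filter.Eventually.of_forall fun s => ?_)
  simp only [Function.comp_apply]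
  rw [inner_lpNegLap_sum, Complex.re_sum]
  simp only [Complex.re_sum, Complex.re_ofReal_mul]
  refine (G.energy_nonneg s fun x => ‖f x‖ / Real.sqrt (G.μ x)).trans ?_
  rw [← sum_negLapEntry_mul]
  refine Finset.sum_le_sum fun x _ => Finset.sum_le_sum fun y _ => ?_
  have hle : (conj (f x) * f y).re ≤ ‖f x‖ * ‖f y‖ := by
    simpa using Complex.re_le_norm (conj (f x) * f y)
  by_cases h : x = y
  · subst h
    refine le_of_eq ?_
    rw [← Complex.normSq_eq_conj_mul_self, Complex.ofReal_re, Complex.normSq_eq_norm_sq, sq]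
  · refine mul_le_mul_of_nonpos_left hle ?_
    rw [negLapEntry, if_neg h, zero_sub]
    exact div_nonpos_of_nonpos_of_nonneg (neg_nonpos.2 (G.edgeWeight_nonneg x y)) (by positivity)

theorem spectrum_negLap_nonneg (hD : G.Dmu < ⊤) {r : ℝ}
    (hr : (r : ℂ) ∈ spectrum ℂ (-G.lapL2 hD)) : 0 ≤ r := by
  rw [← spectrum_lpNegLap] at hr
  refine spectrum_nonneg_of_isPositive ?_ hr
  rw [ContinuousLinearMap.isPositive_def']
  exact ⟨G.isSelfAdjoint_lpNegLap hD, G.re_inner_lpNegLap_nonneg hD⟩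

theorem lambdaStar_nonneg (hD : G.Dmu < ⊤) : 0 ≤ G.lambdaStar hD :=
  Real.sInf_nonneg fun _ hr => G.spectrum_negLap_nonneg hD hr

/-- The variational bound for `λ*` on finitely supported functions. -/
theorem lambdaStar_mul_le_energy (hD : G.Dmu < ⊤) (s : Finset V) (v : V → ℝ) :
    G.lambdaStar hD * ∑ x ∈ s, G.μ x * v x ^ 2 ≤ G.energy s v := by
  classical
  set c : V → ℝ := fun x => Real.sqrt (G.μ x) * v x with hc
  set f : lp (fun _ : V => ℂ) 2 := ∑ x ∈ s, lp.single 2 x (c x : ℂ) with hf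
  have h := mul_norm_sq_le_re_inner (G.isSelfAdjoint_lpNegLap hD) (c := G.lambdaStar hD)
    -- Nonnegativity of the spectrum supplies the lower bound without which `sInf` in `ℝ` would be a
    -- default value.
    (fun r hr => csInf_le ⟨0, fun r hr => G.spectrum_negLap_nonneg hD hr⟩
      (by rwa [spectrum_lpNegLap] at hr)) f
  have hnorm : (⟪f, f⟫_ℂ).re = ∑ x ∈ s, G.μ x * v x ^ 2 := by
    rw [hf, inner_sum, Complex.re_sum]
    refine Finset.sum_congr rfl fun x hx => ?_
    rw [lp.inner_single_right, lp.coeFn_sum, Finset.sum_apply]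
    simp only [lp.single_apply, Finset.sum_pi_single, if_pos hx]
    simp only [hc, RCLike.inner_apply, Complex.conj_ofReal, ← Complex.ofReal_mul, Complex.ofReal_re]
    rw [mul_mul_mul_comm, Real.mul_self_sqrt (G.μ_pos x).le, sq]
  have hen : (⟪G.lpNegLap hD f, f⟫_ℂ).re = G.energy s v := by
    have hv : v = fun x => c x / Real.sqrt (G.μ x) := by
      funext x
      rw [hc, mul_div_cancel_left₀ _ (Real.sqrt_pos.2 (G.μ_pos x)).ne']
    conv_rhs => rw [hv]
    rw [hf, inner_lpNegLap_sum, ← sum_negLapEntry_mul, Complex.re_sum]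
    simp only [Complex.re_sum, Complex.conj_ofReal, ← Complex.ofReal_mul, Complex.ofReal_re]
  rwa [hen, ← inner_self_eq_norm_sq (𝕜 := ℂ), RCLike.re_eq_complex_re, hnorm] at h

/-! ### Davies' method for the Dirichlet heat kernels -/

theorem le_mul_exp_of_deriv_le {g g' : ℝ → ℝ} {k : ℝ} (hg : ∀ s, HasDerivAt g (g' s) s)
    (hle : ∀ s, g' s ≤ k * g s) {t : ℝ} (ht : 0 ≤ t) : g t ≤ g 0 * Real.exp (k * t) := by
  have hd : ∀ s, HasDerivAt (fun s => g s * Real.exp (-(k * s)))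
      (g' s * Real.exp (-(k * s)) + g s * (Real.exp (-(k * s)) * -(k * 1))) s := fun s =>
    (hg s).mul (((hasDerivAt_id s).const_mul k).neg.exp)
  have hanti : Antitone fun s => g s * Real.exp (-(k * s)) :=
    antitone_of_hasDerivAt_nonpos hd fun s => by
      simp only [Pi.zero_apply]
      have := mul_le_mul_of_nonneg_right (hle s) (Real.exp_pos (-(k * s))).le
      linarith
  have h := mul_le_mul_of_nonneg_right (hanti ht) (Real.exp_pos (k * t)).le
  simpa [mul_assoc, ← Real.exp_add] using h

open Classical in
theorem sum_dirichletLap_mul (U : Finset V) (u : U → ℝ) (x : U) :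
    G.μ x * ∑ y, G.dirichletLap U x y * u y
      = ∑ y : U, G.edgeWeight x y * u y - G.deg x * u x := by
  have hμ := (G.μ_pos x).ne'
  have h : ∀ y : U, G.μ x * (G.dirichletLap U x y * u y)
      = G.edgeWeight x y * u y - if x = y then G.deg x * u y else 0 := by
    intro y
    unfold dirichletLap edgeWeight
    by_cases hxy : x = y
    · simp only [if_pos hxy]
      field_simp
    · simp only [if_neg hxy]
      field_simp
      ring
  rw [Finset.mul_sum]
  simp only [h, Finset.sum_sub_distrib, Finset.sum_ite_eq, Finset.mem_univ, if_true]

theorem cosh_le_cosh_of_edge {φ : V → ℝ} (hφ : ∀ x y, G.graph.Adj x y → |φ x - φ y| ≤ 1)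
    (a : ℝ) {x y : V} (h : G.graph.Adj x y) :
    Real.cosh (a * (φ x - φ y)) ≤ Real.cosh a := by
  rw [Real.cosh_le_cosh, abs_mul]
  calc |a| * |φ x - φ y| ≤ |a| * 1 := mul_le_mul_of_nonneg_left (hφ x y h) (abs_nonneg a)
    _ = |a| := mul_one _

/-- Davies' weighted energy estimate. -/
theorem energy_sub_le_weighted (s : Finset V) {φ : V → ℝ}
    (hφ : ∀ x y, G.graph.Adj x y → |φ x - φ y| ≤ 1) (a : ℝ) (u : V → ℝ) :
    G.energy s (fun x => Real.exp (a * φ x) * u x)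
        - (Real.cosh a - 1) * ∑ x ∈ s, G.deg x * (Real.exp (a * φ x) * u x) ^ 2
      ≤ ∑ x ∈ s, Real.exp (a * φ x) ^ 2 * u x
          * (G.deg x * u x - ∑ y ∈ s, G.edgeWeight x y * u y) := by
  set v : V → ℝ := fun x => Real.exp (a * φ x) * u x with hv
  have hcosh : 0 ≤ Real.cosh a - 1 := sub_nonneg.2 (Real.one_le_cosh a)
  have hsplit : ∑ x ∈ s, Real.exp (a * φ x) ^ 2 * u x
        * (G.deg x * u x - ∑ y ∈ s, G.edgeWeight x y * u y)
      = ∑ x ∈ s, G.deg x * v x ^ 2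
        - ∑ x ∈ s, ∑ y ∈ s, G.edgeWeight x y * Real.exp (a * (φ x - φ y)) * (v x * v y) := by
    rw [← Finset.sum_sub_distrib]
    refine Finset.sum_congr rfl fun x _ => ?_
    rw [mul_sub, Finset.mul_sum]
    congr 1
    · simp only [hv]; ring
    · refine Finset.sum_congr rfl fun y _ => ?_
      -- Only one of the two factors `e^{aφ(x)}` is moved to `y`, leaving the ratio
      -- `e^{a(φ(x)-φ(y))}` on the edge.
      have : Real.exp (a * φ x) = Real.exp (a * (φ x - φ y)) * Real.exp (a * φ y) := by
        rw [← Real.exp_add]; ring_nf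
      simp only [hv]
      rw [sq]
      nth_rewrite 2 [this]
      ring
  -- The remaining factors are symmetric in `x` and `y`, so the odd part `sinh` of the exponential
  -- cancels.
  have hsymm : ∑ x ∈ s, ∑ y ∈ s, G.edgeWeight x y * Real.exp (a * (φ x - φ y)) * (v x * v y)
      = ∑ x ∈ s, ∑ y ∈ s, G.edgeWeight x y * Real.cosh (a * (φ x - φ y)) * (v x * v y) := by
    have hswap : ∑ x ∈ s, ∑ y ∈ s, G.edgeWeight x y * Real.exp (a * (φ x - φ y)) * (v x * v y)
        = ∑ x ∈ s, ∑ y ∈ s, G.edgeWeight x y * Real.exp (-(a * (φ x - φ y))) * (v x * v y) := by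
      rw [Finset.sum_comm]
      refine Finset.sum_congr rfl fun x _ => Finset.sum_congr rfl fun y _ => ?_
      rw [G.edgeWeight_comm y x, mul_comm (v y)]
      ring_nf
    have hadd : ∑ x ∈ s, ∑ y ∈ s, G.edgeWeight x y * Real.cosh (a * (φ x - φ y)) * (v x * v y)
        = (∑ x ∈ s, ∑ y ∈ s, G.edgeWeight x y * Real.exp (a * (φ x - φ y)) * (v x * v y)
          + ∑ x ∈ s, ∑ y ∈ s, G.edgeWeight x y * Real.exp (-(a * (φ x - φ y))) * (v x * v y))
            / 2 := by
      simp only [← Finset.sum_add_distrib, Finset.sum_div, Real.cosh_eq]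
      refine Finset.sum_congr rfl fun x _ => Finset.sum_congr rfl fun y _ => ?_
      ring
    linarith
  have hterm : ∑ x ∈ s, ∑ y ∈ s, G.edgeWeight x y * Real.cosh (a * (φ x - φ y)) * (v x * v y)
      ≤ ∑ x ∈ s, ∑ y ∈ s, G.edgeWeight x y * (v x * v y)
        + (Real.cosh a - 1) * ∑ x ∈ s, ∑ y ∈ s, G.edgeWeight x y * |v x * v y| := by
    simp only [Finset.mul_sum, ← Finset.sum_add_distrib]
    refine Finset.sum_le_sum fun x _ => Finset.sum_le_sum fun y _ => ?_
    by_cases h : G.graph.Adj x y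
    · have h1 := G.cosh_le_cosh_of_edge hφ a h
      have h2 : (Real.cosh (a * (φ x - φ y)) - 1) * (v x * v y)
          ≤ (Real.cosh a - 1) * |v x * v y| :=
        (mul_le_mul_of_nonneg_left (le_abs_self _) (sub_nonneg.2 (Real.one_le_cosh _))).trans
          (mul_le_mul_of_nonneg_right (by linarith) (abs_nonneg _))
      have h3 := mul_le_mul_of_nonneg_left h2 (G.edgeWeight_nonneg x y)
      linarith
    · simp [edgeWeight, h]
  have hbound := mul_le_mul_of_nonneg_left (G.sum_edgeWeight_mul_le s v) hcosh
  rw [hsplit, hsymm, energy]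
  linarith

theorem hasDerivAt_exp_smul_apply {n : Type*} [Fintype n] [DecidableEq n] (A : Matrix n n ℝ)
    (i j : n) (s : ℝ) :
    HasDerivAt (fun s : ℝ => NormedSpace.exp (s • A) i j)
      (∑ k, A i k * NormedSpace.exp (s • A) k j) s := by
  -- A choice of norm is needed only to differentiate; the conclusion is entrywise.
  let _ : NormedRing (Matrix n n ℝ) := Matrix.linftyOpNormedRing
  let _ : NormedAlgebra ℝ (Matrix n n ℝ) := Matrix.linftyOpNormedAlgebra
  have h := hasDerivAt_exp_smul_const' (𝕂 := ℝ) A s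
  exact (hasDerivAt_pi.1 ((hasDerivAt_pi.1 h) i)) j

open Classical in
/-- The Davies–Gaffney estimate for the Dirichlet heat kernel. -/
theorem weighted_dirichletHeatKernel_le (hD : G.Dmu < ⊤) (U : Finset V) {φ : V → ℝ}
    (hφ : ∀ x y, G.graph.Adj x y → |φ x - φ y| ≤ 1) (a : ℝ) {t : ℝ} (ht : 0 ≤ t)
    (x y : V) :
    G.dirichletHeatKernel U t x y
      ≤ Real.exp (-(G.lambdaStar hD - G.Dmu.toReal * (Real.cosh a - 1)) * t - a * (φ x - φ y))
        / Real.sqrt (G.μ x * G.μ y) := by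
  unfold dirichletHeatKernel
  split_ifs with hU
  swap
  · positivity
  obtain ⟨hx, hy⟩ := hU
  set c := G.lambdaStar hD - G.Dmu.toReal * (Real.cosh a - 1) with hc
  set A := G.dirichletLap U with hA
  -- The column of the semigroup at `y`, extended by zero: it solves the Dirichlet heat equation
  -- started from the indicator of `y`.
  set u : ℝ → V → ℝ := fun s z =>
    if hz : z ∈ U then NormedSpace.exp (s • A) ⟨z, hz⟩ ⟨y, hy⟩ else 0 with hu
  have hu_val : ∀ s (z : U), u s z = NormedSpace.exp (s • A) z ⟨y, hy⟩ := fun s z => by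
    simp [hu]
  set g : ℝ → ℝ := fun s => ∑ z ∈ U, G.μ z * (Real.exp (a * φ z) * u s z) ^ 2 with hg
  have hderiv : ∀ s, ∀ z ∈ U, HasDerivAt (fun s => u s z)
      ((∑ w ∈ U, G.edgeWeight z w * u s w - G.deg z * u s z) / G.μ z) s := by
    intro s z hz
    have h := hasDerivAt_exp_smul_apply A ⟨z, hz⟩ ⟨y, hy⟩ s
    have h2 := G.sum_dirichletLap_mul U (fun w => u s w) ⟨z, hz⟩
    rw [Finset.univ_eq_attach, Finset.sum_attach U fun w => G.edgeWeight z w * u s w] at h2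
    rw [← h2, mul_div_cancel_left₀ _ (G.μ_pos z).ne']
    simp only [hu_val]
    refine HasDerivAt.congr_of_eventuallyEq h (Filter.Eventually.of_forall fun s => ?_)
    exact hu_val s ⟨z, hz⟩
  set g' : ℝ → ℝ := fun s => -2 * ∑ z ∈ U, Real.exp (a * φ z) ^ 2 * u s z
    * (G.deg z * u s z - ∑ w ∈ U, G.edgeWeight z w * u s w) with hg'
  have hgd : ∀ s, HasDerivAt g (g' s) s := by
    intro s
    have h := HasDerivAt.fun_sum (u := U) fun z hz =>
      ((((hderiv s z hz).const_mul (Real.exp (a * φ z))).fun_pow 2).const_mul (G.μ z))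
    refine h.congr_deriv ?_
    simp only [hg']
    rw [Finset.mul_sum]
    refine Finset.sum_congr rfl fun z _ => ?_
    have := (G.μ_pos z).ne'
    push_cast
    field_simp
    ring
  -- The differential inequality: Davies' estimate, then the spectral gap for the energy and `deg ≤
  -- D_μ μ` for the error.
  have hle : ∀ s, g' s ≤ -(2 * c) * g s := by
    intro s
    have h1 := G.energy_sub_le_weighted U hφ a (u s)
    have h2 := G.lambdaStar_mul_le_energy hD U fun z => Real.exp (a * φ z) * u s z
    have h3 : ∑ z ∈ U, G.deg z * (Real.exp (a * φ z) * u s z) ^ 2 ≤ G.Dmu.toReal * g s := by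
      rw [hg, Finset.mul_sum]
      refine Finset.sum_le_sum fun z _ => ?_
      rw [← mul_assoc]
      exact mul_le_mul_of_nonneg_right (G.deg_le hD z) (sq_nonneg _)
    have h4 := mul_le_mul_of_nonneg_left h3 (sub_nonneg.2 (Real.one_le_cosh a))
    simp only [hg', hc]
    simp only [hg] at h4 ⊢
    linarith
  have hmain := le_mul_exp_of_deriv_le hgd hle ht
  have hg0 : g 0 = G.μ y * Real.exp (a * φ y) ^ 2 := by
    rw [hg]
    refine (Finset.sum_eq_single_of_mem y hy fun z hz hzy => ?_).trans ?_
    · simp [hu, hz, hzy]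
    · simp [hu, hy]
  have hgt : G.μ x * (Real.exp (a * φ x) * u t x) ^ 2 ≤ g t :=
    Finset.single_le_sum (f := fun z => G.μ z * (Real.exp (a * φ z) * u t z) ^ 2)
      (fun z _ => mul_nonneg (G.μ_pos z).le (sq_nonneg _)) hx
  have hux : NormedSpace.exp (t • A) ⟨x, hx⟩ ⟨y, hy⟩ = u t x := (hu_val t ⟨x, hx⟩).symm
  rw [hux]
  have hsx := Real.sqrt_pos.2 (G.μ_pos x)
  have hsy := Real.sqrt_pos.2 (G.μ_pos y)
  have hsq : (Real.sqrt (G.μ x) * (Real.exp (a * φ x) * u t x)) ^ 2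
      ≤ (Real.sqrt (G.μ y) * Real.exp (a * φ y) * Real.exp (-c * t)) ^ 2 := by
    rw [mul_pow, Real.sq_sqrt (G.μ_pos x).le, mul_pow _ (Real.exp (-c * t)),
      mul_pow (Real.sqrt (G.μ y)), Real.sq_sqrt (G.μ_pos y).le,
      ← Real.exp_nat_mul (-c * t), ← hg0]
    refine (hgt.trans hmain).trans (le_of_eq ?_)
    congr 2
    push_cast
    ring
  have hfin := (abs_le_of_sq_le_sq' hsq (by positivity)).2
  rw [Real.sqrt_mul (G.μ_pos x).le, div_le_div_iff₀ (G.μ_pos y) (mul_pos hsx hsy)]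
  have hexp : Real.exp (-c * t - a * (φ x - φ y)) * Real.exp (a * φ x)
      = Real.exp (a * φ y) * Real.exp (-c * t) := by
    rw [← Real.exp_add, ← Real.exp_add]; ring_nf
  refine le_of_mul_le_mul_right ?_ (Real.exp_pos (a * φ x))
  calc u t x * (Real.sqrt (G.μ x) * Real.sqrt (G.μ y)) * Real.exp (a * φ x)
      = Real.sqrt (G.μ x) * (Real.exp (a * φ x) * u t x) * Real.sqrt (G.μ y) := by ring
    _ ≤ Real.sqrt (G.μ y) * Real.exp (a * φ y) * Real.exp (-c * t) * Real.sqrt (G.μ y) :=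
        mul_le_mul_of_nonneg_right hfin hsy.le
    _ = Real.exp (-c * t - a * (φ x - φ y)) * Real.exp (a * φ x)
          * (Real.sqrt (G.μ y) * Real.sqrt (G.μ y)) := by rw [hexp]; ring
    _ = _ := by rw [Real.mul_self_sqrt (G.μ_pos y).le]; ring

/-! ### Exponential volume growth and Lipschitz distance -/

theorem μ_le_mul_w (hd : G.dsup < ⊤) {x y : V} (h : G.graph.Adj x y) :
    G.μ x ≤ G.dsup.toReal * G.w x y := by
  have h1 : ENNReal.ofReal (G.μ x / G.w x y) ≤ G.dsup :=
    le_iSup_of_le x (le_iSup_of_le y (le_iSup_of_le h le_rfl))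
  exact (div_le_iff₀ (G.w_pos x y h)).1 ((ENNReal.ofReal_le_iff_le_toReal hd.ne).1 h1)

theorem sum_biUnion_le [DecidableEq V] (s : Finset V) (t : V → Finset V) {f : V → ℝ}
    (hf : ∀ x, 0 ≤ f x) : ∑ y ∈ s.biUnion t, f y ≤ ∑ z ∈ s, ∑ y ∈ t z, f y := by
  induction s using Finset.induction_on with
  | empty => simp
  | insert a s ha ih =>
    rw [Finset.biUnion_insert, Finset.sum_insert ha]
    have h := Finset.sum_union_inter (s₁ := t a) (s₂ := s.biUnion t) (f := f)
    have h0 : 0 ≤ ∑ y ∈ t a ∩ s.biUnion t, f y := Finset.sum_nonneg fun y _ => hf y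
    linarith

open Classical in
/-- The vertices within distance `n` of `x`, as a finite set. -/
def finsetBall (x : V) : ℕ → Finset V
  | 0 => {x}
  | n + 1 => finsetBall x n ∪ (finsetBall x n).biUnion G.nbrs

theorem mem_finsetBall_of_walk {x y : V} (p : G.graph.Walk x y) :
    ∀ n, p.length ≤ n → y ∈ G.finsetBall x n := by
  induction p using SimpleGraph.Walk.concatRec with
  | Hnil =>
    intro n _
    induction n with
    | zero => simp [finsetBall]
    | succ n ih => classical exact Finset.mem_union_left _ (ih (Nat.zero_le _))
  | Hconcat p h ih =>
    intro n hn
    rw [SimpleGraph.Walk.length_concat] at hn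
    obtain ⟨m, rfl⟩ : ∃ m, n = m + 1 := ⟨n - 1, by omega⟩
    simp only [finsetBall, Finset.mem_union, Finset.mem_biUnion]
    exact Or.inr ⟨_, ih m (by omega), G.mem_nbrs.2 h⟩

theorem ball_subset_finsetBall (x : V) (r : ℝ) : G.ball x r ⊆ G.finsetBall x ⌊r⌋₊ := by
  rintro y ⟨hxy, hr⟩
  obtain ⟨p, hp⟩ := hxy.exists_walk_length_eq_dist
  exact G.mem_finsetBall_of_walk p _ (hp ▸ Nat.le_floor hr)

/-- One step outward multiplies the volume by at most `1 + d D_μ`: a neighbour `y` of `z` has `μ y ≤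
d w y z = d w z y`, and these sum to at most `d deg z ≤ d D_μ μ z`. -/
theorem sum_finsetBall_le (hD : G.Dmu < ⊤) (hd : G.dsup < ⊤) (x : V) (n : ℕ) :
    ∑ y ∈ G.finsetBall x n, G.μ y ≤ (1 + G.dsup.toReal * G.Dmu.toReal) ^ n * G.μ x := by
  classical
  induction n with
  | zero => simp [finsetBall]
  | succ n ih =>
    have hstep : ∀ z, ∑ y ∈ G.nbrs z, G.μ y ≤ G.dsup.toReal * G.Dmu.toReal * G.μ z := by
      intro z
      calc ∑ y ∈ G.nbrs z, G.μ y ≤ ∑ y ∈ G.nbrs z, G.dsup.toReal * G.w z y := by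
            refine Finset.sum_le_sum fun y hy => ?_
            have h := G.mem_nbrs.1 hy
            rw [G.w_symm z y h]
            exact G.μ_le_mul_w hd h.symm
        _ = G.dsup.toReal * G.deg z := by rw [← Finset.mul_sum, deg]
        _ ≤ G.dsup.toReal * (G.Dmu.toReal * G.μ z) :=
            mul_le_mul_of_nonneg_left (G.deg_le hD z) ENNReal.toReal_nonneg
        _ = _ := by ring
    calc ∑ y ∈ G.finsetBall x (n + 1), G.μ y
        ≤ ∑ y ∈ G.finsetBall x n, G.μ y + ∑ y ∈ (G.finsetBall x n).biUnion G.nbrs, G.μ y := by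
          rw [finsetBall, ← Finset.sum_union_inter]
          exact le_add_of_nonneg_right (Finset.sum_nonneg fun y _ => (G.μ_pos y).le)
      _ ≤ ∑ y ∈ G.finsetBall x n, G.μ y + ∑ z ∈ G.finsetBall x n, ∑ y ∈ G.nbrs z, G.μ y := by
          gcongr
          exact sum_biUnion_le _ _ fun y => (G.μ_pos y).le
      _ ≤ ∑ y ∈ G.finsetBall x n, G.μ y
            + ∑ z ∈ G.finsetBall x n, G.dsup.toReal * G.Dmu.toReal * G.μ z := by
          gcongr with z _
          exact hstep z
      _ = (1 + G.dsup.toReal * G.Dmu.toReal) * ∑ y ∈ G.finsetBall x n, G.μ y := by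
          rw [← Finset.mul_sum]; ring
      _ ≤ (1 + G.dsup.toReal * G.Dmu.toReal)
            * ((1 + G.dsup.toReal * G.Dmu.toReal) ^ n * G.μ x) := by gcongr
      _ = _ := by ring

theorem vol_eq_sum (x : V) (r : ℝ) :
    ∃ s : Finset V, (s : Set V) = G.ball x r ∧ G.vol x r = ∑ y ∈ s, G.μ y := by
  have hfin : (G.ball x r).Finite :=
    (G.finsetBall x ⌊r⌋₊).finite_toSet.subset (G.ball_subset_finsetBall x r)
  refine ⟨hfin.toFinset, hfin.coe_toFinset, ?_⟩
  rw [vol, finsum_mem_eq_finite_toFinset_sum _ hfin]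

theorem μ_le_vol (x : V) {r : ℝ} (hr : 0 ≤ r) : G.μ x ≤ G.vol x r := by
  obtain ⟨s, hs, hvol⟩ := G.vol_eq_sum x r
  rw [hvol]
  refine Finset.single_le_sum (f := G.μ) (fun y _ => (G.μ_pos y).le) ?_
  rw [← Finset.mem_coe, hs]
  exact ⟨SimpleGraph.Reachable.refl x, by simpa using hr⟩

theorem vol_le (hD : G.Dmu < ⊤) (hd : G.dsup < ⊤) (x : V) {r : ℝ} (hr : 0 ≤ r) :
    G.vol x r ≤ Real.exp (Real.log (1 + G.dsup.toReal * G.Dmu.toReal) * r) * G.μ x := by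
  obtain ⟨s, hs, hvol⟩ := G.vol_eq_sum x r
  have hpos : (1 : ℝ) ≤ 1 + G.dsup.toReal * G.Dmu.toReal :=
    le_add_of_nonneg_right (by positivity)
  rw [hvol, ← Real.rpow_def_of_pos (by linarith)]
  calc ∑ y ∈ s, G.μ y ≤ ∑ y ∈ G.finsetBall x ⌊r⌋₊, G.μ y := by
        refine Finset.sum_le_sum_of_subset_of_nonneg ?_ fun y _ _ => (G.μ_pos y).le
        rw [← Finset.coe_subset, hs]
        exact G.ball_subset_finsetBall x r
    _ ≤ _ := G.sum_finsetBall_le hD hd x _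
    _ ≤ _ := by
        rw [← Real.rpow_natCast]
        exact mul_le_mul_of_nonneg_right
          (Real.rpow_le_rpow_of_exponent_le hpos (Nat.floor_le hr)) (G.μ_pos x).le

/-- Adjacent vertices lie in one component, so the default distance `0` to other components does no
harm. -/
theorem abs_dist_sub_dist_le (z : V) {x y : V} (h : G.graph.Adj x y) :
    |(G.graph.dist z x : ℝ) - G.graph.dist z y| ≤ 1 := by
  have h1 := h.diff_dist_adj (u := z)
  rw [abs_le]
  rcases h1 with h1 | h1 | h1
  · rw [h1]; norm_num
  · rw [h1]; push_cast; constructor <;> linarith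
  · have : (G.graph.dist z x : ℝ) ≤ G.graph.dist z y + 1 ∧
        (G.graph.dist z y : ℝ) ≤ G.graph.dist z x := by
      constructor <;> (norm_cast; omega)
    constructor <;> linarith [this.1, this.2]

end WeightedGraph

/-! ### Choice of the slope and conclusion -/

theorem Real.cosh_sub_one_le_sq {a : ℝ} (h₀ : 0 ≤ a) (h₁ : a ≤ 1) : Real.cosh a - 1 ≤ a ^ 2 := by
  have h : Real.cosh a ≤ Real.exp (a ^ 2 / 2) := Real.cosh_le_exp_half_sq a
  have h2 := Real.abs_exp_sub_one_le (x := a ^ 2 / 2) (by rw [abs_of_nonneg] <;> nlinarith)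
  rw [abs_of_nonneg (by positivity : 0 ≤ a ^ 2 / 2)] at h2
  linarith [le_abs_self (Real.exp (a ^ 2 / 2) - 1)]

/-- The exponent in the Davies–Gaffney estimate, for a suitable slope of the weight. -/
theorem exists_slope {D κ β ρ t : ℝ} (hD : 0 ≤ D) (hκ : 0 < κ) (hκβ : κ ≤ β)
    (hκD : 2 * (D + 1) * κ ≤ 1) (hρ : 0 ≤ ρ) (ht : 0 < t) (hρt : β * ρ ≤ t) :
    ∃ a, D * (Real.cosh a - 1) * t - a * ρ ≤ -(κ * (ρ ^ 2 / (2 * t))) := by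
  have ha₀ : 0 ≤ κ * ρ / t := by positivity
  have ha₁ : κ * ρ / t ≤ 1 := by
    rw [div_le_one ht]
    exact (mul_le_mul_of_nonneg_right hκβ hρ).trans hρt
  -- Since `κ ≤ β` forces `a ≤ 1`, the exponent is at most `D a² t - a ρ = -(1 - D κ) κ ρ² / t`, and
  -- `2 D κ ≤ 1` leaves at least half of the gain.
  refine ⟨κ * ρ / t, ?_⟩
  have h1 : D * (Real.cosh (κ * ρ / t) - 1) * t ≤ D * (κ * ρ / t) ^ 2 * t := by
    have := Real.cosh_sub_one_le_sq ha₀ ha₁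
    gcongr
  have h2 : D * (κ * ρ / t) ^ 2 * t = (2 * D * κ) * (κ * (ρ ^ 2 / (2 * t))) := by
    field_simp
  have h3 : κ * ρ / t * ρ = 2 * (κ * (ρ ^ 2 / (2 * t))) := by
    field_simp
  have h4 : (2 * D * κ) * (κ * (ρ ^ 2 / (2 * t))) ≤ 1 * (κ * (ρ ^ 2 / (2 * t))) := by
    gcongr
    nlinarith
  linarith

end

theorem theorem4 (β γ : ℝ) (hβ : 0 < β) (hγ₀ : 0 < γ) (hγ₁ : γ ≤ 1) (D : ℝ≥0∞) (hD : D < ⊤) :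
    ∃ C₁ : ℝ, 0 < C₁ ∧
      ∀ ε : ℝ, 0 < ε → ∀ d μmax wmin : ℝ≥0∞, d < ⊤ → μmax < ⊤ → 0 < wmin →
        ∃ C₂ : ℝ, 0 < C₂ ∧
          ∀ (V : Type u) (G : WeightedGraph V) (hG : G.Dmu < ⊤),
            G.Dmu = D → G.dsup = d → G.muMax = μmax → G.wMin = wmin →
            ∀ (x y : V) (t : ℝ), G.graph.Reachable x y →
              max (β * (G.graph.dist x y : ℝ)) 1 ≤ t →
              G.heatKernel t x y ≤
                Real.exp (-(1 - γ) * G.lambdaStar hG * t) /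
                    Real.sqrt (G.vol x (Real.sqrt t) * G.vol y (Real.sqrt t)) *
                  Real.exp (C₂ * Real.sqrt t -
                    C₁ * ((G.graph.dist x y : ℝ) ^ 2 / (4 * (1 + 2 * ε) * t))) := by
  have hD0 : 0 ≤ D.toReal := ENNReal.toReal_nonneg
  obtain ⟨κ, hκ, hκβ, hκD⟩ : ∃ κ : ℝ, 0 < κ ∧ κ ≤ β ∧ 2 * (D.toReal + 1) * κ ≤ 1 := by
    refine ⟨min β (1 / (2 * (D.toReal + 1))), lt_min hβ (by positivity), min_le_left _ _, ?_⟩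
    calc 2 * (D.toReal + 1) * min β (1 / (2 * (D.toReal + 1)))
        ≤ 2 * (D.toReal + 1) * (1 / (2 * (D.toReal + 1))) := by
          gcongr
          exact min_le_right _ _
      _ = 1 := by field_simp
  -- `C₁ = 2κ` because `κ ρ²/(2t) = 2κ ρ²/(4t)`; the factor `1 + 2ε` only weakens the bound.
  refine ⟨2 * κ, by positivity, fun ε hε d μmax wmin hd _ _ => ?_⟩
  have hlog : 0 ≤ Real.log (1 + d.toReal * D.toReal) :=
    Real.log_nonneg (le_add_of_nonneg_right (by positivity))
  -- The logarithm is the volume growth rate; the extra `1` keeps `C₂` positive when that rate is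
  -- zero.
  refine ⟨Real.log (1 + d.toReal * D.toReal) + 1, by positivity, ?_⟩
  rintro V G hG rfl rfl - - x y t - ht
  have ht1 : 1 ≤ t := (le_max_right _ _).trans ht
  have ht0 : 0 < t := by linarith
  have hρt : β * (G.graph.dist x y : ℝ) ≤ t := (le_max_left _ _).trans ht
  obtain ⟨a, hslope⟩ := exists_slope hD0 hκ hκβ hκD (Nat.cast_nonneg (G.graph.dist x y)) ht0 hρt
  set ρ : ℝ := (G.graph.dist x y : ℝ) with hρ
  set L := Real.log (1 + G.dsup.toReal * G.Dmu.toReal) with hL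
  have hr := Real.sqrt_nonneg t
  have hvx : 0 < G.vol x (Real.sqrt t) := (G.μ_pos x).trans_le (G.μ_le_vol x hr)
  have hvy : 0 < G.vol y (Real.sqrt t) := (G.μ_pos y).trans_le (G.μ_le_vol y hr)
  have hvol : Real.sqrt (G.vol x (Real.sqrt t) * G.vol y (Real.sqrt t))
      ≤ Real.exp (L * Real.sqrt t) * Real.sqrt (G.μ x * G.μ y) := by
    refine Real.sqrt_le_iff.2 ⟨by positivity, ?_⟩
    rw [mul_pow, Real.sq_sqrt (mul_pos (G.μ_pos x) (G.μ_pos y)).le, sq, mul_mul_mul_comm]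
    exact mul_le_mul (G.vol_le hG hd x hr) (G.vol_le hG hd y hr) hvy.le
      (mul_nonneg (Real.exp_pos _).le (G.μ_pos x).le)
  have hkernel : G.heatKernel t x y
      ≤ Real.exp (-(G.lambdaStar hG - G.Dmu.toReal * (Real.cosh a - 1)) * t - a * ρ)
        / Real.sqrt (G.μ x * G.μ y) := by
    -- The bound is uniform in `U`, so it passes to the supremum without monotonicity in `U`.
    refine ciSup_le fun U => ?_
    have h := G.weighted_dirichletHeatKernel_le hG U (φ := fun z => (G.graph.dist y z : ℝ))
      (fun _ _ h => G.abs_dist_sub_dist_le y h) a ht0.le x y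
    simpa [hρ, SimpleGraph.dist_comm] using h
  have hexponent : -(G.lambdaStar hG - G.Dmu.toReal * (Real.cosh a - 1)) * t - a * ρ
        + L * Real.sqrt t
      ≤ -(1 - γ) * G.lambdaStar hG * t
        + ((L + 1) * Real.sqrt t - 2 * κ * (ρ ^ 2 / (4 * (1 + 2 * ε) * t))) := by
    -- The kernel bound decays at the full rate `λ*`; the share `γ λ* t` is given away.
    have h1 : 0 ≤ γ * G.lambdaStar hG * t :=
      mul_nonneg (mul_nonneg hγ₀.le (G.lambdaStar_nonneg hG)) ht0.le
    have h2 : 2 * κ * (ρ ^ 2 / (4 * (1 + 2 * ε) * t)) ≤ κ * (ρ ^ 2 / (2 * t)) := by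
      calc 2 * κ * (ρ ^ 2 / (4 * (1 + 2 * ε) * t)) ≤ 2 * κ * (ρ ^ 2 / (4 * 1 * t)) := by
            gcongr
            linarith
        _ = κ * (ρ ^ 2 / (2 * t)) := by field_simp; ring
    linarith
  have hsμ : 0 < Real.sqrt (G.μ x * G.μ y) :=
    Real.sqrt_pos.2 (mul_pos (G.μ_pos x) (G.μ_pos y))
  refine hkernel.trans ?_
  rw [div_mul_eq_mul_div, ← Real.exp_add, div_le_div_iff₀ hsμ (Real.sqrt_pos.2 (mul_pos hvx hvy))]
  refine (mul_le_mul_of_nonneg_left hvol (Real.exp_pos _).le).trans ?_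
  rw [← mul_assoc, ← Real.exp_add]
  exact mul_le_mul_of_nonneg_right (Real.exp_le_exp.2 hexponent) hsμ.le
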